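/- **Setting.** Let $\mathcal H=L^2(\mathbb R;\mathbb C)$ be the Hilbert space of a single bosonic mode, with position $\hat x$, momentum $\hat p=-i\,\mathrm d/\mathrm dx$, number operator $\hat n$, Fock basis $(|n\rangle)_{n\ge 0}$ (the Hermite functions) and coherent states $|\alpha\rangle=e^{-|\alpha|^2/2}\sum_n\frac{\alpha^n}{\sqrt{n!}}|n\rangle$. A state is a positive trace class operator on $\mathcal H$ of trace one. For $\theta\in\mathbb R$ let $\hat q_\theta=\cos\theta\,\hat x+\sin\theta\,\hat p$, with spectral projectors $\mathbf 1_B(\hat q_\theta)=\int_B|q\rangle\langle q|_{\hat q_\theta}\,\mathrm dq$ for Borel sets $B\subseteq\mathbb R$. Measuring $\hat q_\theta$ on a state $\hat\sigma$ gives a real outcome $X$ with law $\Pr[X\in B]=\mathrm{Tr}[\hat\sigma\,\mathbf 1_B(\hat q_\theta)]$. The energy of a unit vector $\psi$ is $\langle\hat n\rangle_\psi=\sum_n n|\langle n|\psi\rangle|^2\in[0,\infty]$. For $E\ge 0$, $\mathcal S^E$ is the trace-norm closure, within the set of states, of the convex hull of $\{|\psi\rangle\langle\psi| : \|\psi\|=1,\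 \langle\hat n\rangle_\psi\le E\}$. The stellar rank $r^\star(\psi)\in\mathbb N\cup\{\infty\}$ of a unit vector is the number of zeros in $\mathbb C$, counted with multiplicity, of the entire function $\alpha\mapsto e^{|\alpha|^2/2}\langle\alpha^*|\psi\rangle$. The stellar rank of a state $\hat\rho$ is the infimum, over all (discrete or continuous) statistical mixtures $\hat\rho=\int|\psi_\omega\rangle\langle\psi_\omega|\,\mathrm d\mu(\omega)$ with $\mu$ a probability measure and $\psi_\omega$ unit vectors, of the $\mu$-essential supremum of $r^\star(\psi_\omega)$. Let $\mathcal S_0^E$ be the set of $\hat\rho\in\mathcal S^E$ of stellar rank $0$ (the Gaussian states of energy at most $E$). Let $N\in\mathbb N$, and let $\theta_j,x_j\in\mathbb R$, $\eta_j>0$ for $j=1,\dots,N$. Put $I_j=[x_j-\frac{\eta_j}2,\,x_j+\frac{\eta_j}2]$ and $$\hat W=\sum_{j=1}^N\mathbf 1_{I_j}(\hat q_{\theta_j}),\qquad w^E=\inf_{\hat\tau\in\mathcal S_0^E}\mathrm{Tr}[\hat\tau\,\hat W].$$ **Theorem (sample complexity for multiple-quadrature witnesses).** Let $E\ge 0$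 and $\hat\sigma\in\mathcal S_0^E$. For each $j=1,\dots,N$ let $q_{j,1},\dots,q_{j,M_j}$ ($M_j\in\mathbb N$) be independent outcomes of the measurement of $\hat q_{\theta_j}$ on $\hat\sigma$, all defined on one probability space; outcomes for different $j$ are not required to be independent of each other. Let $$\bar w_j=\frac1{M_j}\,\#\{k : q_{j,k}\in I_j\}$$ (read as $0$ if $M_j=0$). Then for every $\epsilon>0$, $$\Pr\Big[\sum_{j=1}^N\bar w_j<w^E-\epsilon\Big]\le\sum_{j=1}^N\exp\Big(-2M_j\Big(\frac{\epsilon}{N}\Big)^2\Big).$$ -/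

import Mathlib

open MeasureTheory ProbabilityTheory
open scoped ENNReal InnerProductSpace

noncomputable section

namespace Bosonic

/-- The Hilbert space `L²(ℝ; ℂ)` of a single bosonic mode, in position representation. -/
abbrev Mode : Type := Lp ℂ 2 (volume : Measure ℝ)

/-! ### Fock states, energy, coherent states, stellar rank of pure states -/

theorem integrable_polynomial_mul_gaussian (p : Polynomial ℝ) :
    Integrable (fun x : ℝ => p.eval x * Real.exp (-1 * x ^ 2)) volume := by
  induction p using Polynomial.induction_on' with
  | add p q hp hq =>
    refine (hp.add hq).congr (Filter.Eventually.of_forall fun x => ?_)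
    simp only [Pi.add_apply, Polynomial.eval_add]
    ring
  | monomial n a =>
    have h := (integrable_rpow_mul_exp_neg_mul_sq (b := 1) one_pos
      (s := (n : ℝ)) (by have := n.cast_nonneg (α := ℝ); linarith)).const_mul a
    refine h.congr (Filter.Eventually.of_forall fun x => ?_)
    simp only [Polynomial.eval_monomial, Real.rpow_natCast]
    ring

/-- The `n`-th Hermite function `(n! √π)^{-1/2} Heₙ(√2 x) exp(-x²/2)`, where `Heₙ` is the
probabilists' Hermite polynomial.  In terms of the physicists' polynomial this is
`(2ⁿ n! √π)^{-1/2} Hₙ(x) exp(-x²/2)`, the wavefunction of the Fock state `|n⟩`. -/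
def hermiteFun (n : ℕ) (x : ℝ) : ℂ :=
  (((√(n.factorial * √Real.pi))⁻¹ * Polynomial.aeval (√2 * x) (Polynomial.hermite n) *
    Real.exp (-x ^ 2 / 2) : ℝ) : ℂ)

theorem memLp_hermiteFun (n : ℕ) : MemLp (hermiteFun n) 2 volume := by
  have hm : AEStronglyMeasurable (hermiteFun n) volume := by
    apply Continuous.aestronglyMeasurable
    unfold hermiteFun
    fun_prop
  rw [memLp_two_iff_integrable_sq_norm hm]
  set c : ℝ := (√(n.factorial * √Real.pi))⁻¹
  set p : Polynomial ℝ := Polynomial.C c *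
    ((Polynomial.hermite n).map (algebraMap ℤ ℝ)).comp (Polynomial.C √2 * Polynomial.X)
  refine (integrable_polynomial_mul_gaussian (p ^ 2)).congr
    (Filter.Eventually.of_forall fun x => ?_)
  have hexp : Real.exp (-1 * x ^ 2) = Real.exp (-x ^ 2 / 2) ^ 2 := by
    rw [← Real.exp_nat_mul]
    congr 1
    push_cast
    ring
  have hp : p.eval x = c * Polynomial.aeval (√2 * x) (Polynomial.hermite n) := by
    simp [p, Polynomial.eval_comp, Polynomial.aeval_def, Polynomial.eval_map]
  simp only [hermiteFun, Complex.norm_real, Real.norm_eq_abs, sq_abs, Polynomial.eval_pow]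
  rw [hp, hexp]
  ring

/-- The Fock state `|n⟩`, the `n`-th eigenvector of the number operator. -/
def fock (n : ℕ) : Mode := (memLp_hermiteFun n).toLp (hermiteFun n)

/-- The energy `⟨n̂⟩_ψ = ∑ₙ n |⟨n|ψ⟩|²` (possibly infinite). -/
def energy (ψ : Mode) : ℝ≥0∞ :=
  ∑' n : ℕ, (n : ℝ≥0∞) * ENNReal.ofReal (‖⟪fock n, ψ⟫_ℂ‖ ^ 2)

/-- The coherent state `|α⟩ = exp(-|α|²/2) ∑ₙ αⁿ/√(n!) |n⟩`. -/
def coherent (α : ℂ) : Mode :=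
  Complex.exp (-(‖α‖ : ℂ) ^ 2 / 2) • ∑' n : ℕ, (α ^ n / (√(n.factorial : ℝ) : ℂ)) • fock n

/-- The stellar function `α ↦ exp(|α|²/2) ⟨α*|ψ⟩`. -/
def stellarFun (ψ : Mode) (α : ℂ) : ℂ :=
  Complex.exp ((‖α‖ : ℂ) ^ 2 / 2) * ⟪coherent (star α), ψ⟫_ℂ

/-- The stellar rank of a pure state: the number of zeros of its stellar function (an entire
function), counted with multiplicity. -/
def stellarRank (ψ : Mode) : ℕ∞ :=
  ⨆ s : Finset ℂ, ∑ z ∈ s, analyticOrderAt (stellarFun ψ) z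

/-! ### Trace, trace norm, quantum states -/

variable {H : Type*} [NormedAddCommGroup H] [InnerProductSpace ℂ H] [CompleteSpace H]

variable (H) in
/-- The index type of some Hilbert basis of `H`. -/
def BasisIndex : Set H := (exists_hilbertBasis ℂ H).choose

variable (H) in
/-- Some Hilbert basis of `H`. -/
def someBasis : HilbertBasis (BasisIndex H) ℂ H := (exists_hilbertBasis ℂ H).choose_spec.choose

/-- The trace `∑ᵢ ⟨eᵢ, T eᵢ⟩` of a (trace class) operator.  For trace class operators the value
does not depend on the Hilbert basis. -/
def trace (T : H →L[ℂ] H) : ℂ := ∑' i, ⟪someBasis H i, T (someBasis H i)⟫_ℂ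

/-- The trace norm `‖T‖₁ = Tr |T|`, infinite if `T` is not trace class. -/
def traceNorm (T : H →L[ℂ] H) : ℝ≥0∞ :=
  ∑' i, ENNReal.ofReal (⟪someBasis H i, CFC.abs T (someBasis H i)⟫_ℂ).re

/-- Quantum states: positive trace class operators of trace one. -/
def IsState (ρ : Mode →L[ℂ] Mode) : Prop :=
  ρ.IsPositive ∧ traceNorm ρ = 1

/-- The rank-one operator `|ψ⟩⟨ψ|`. -/
def pureState (ψ : Mode) : Mode →L[ℂ] Mode := InnerProductSpace.rankOne ℂ ψ ψ

/-- `𝒮^E`: the trace-norm closed convex hull of the pure states of energy at most `E`. -/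
def energyBounded (E : ℝ) : Set (Mode →L[ℂ] Mode) :=
  {ρ | IsState ρ ∧ ∀ ε : ℝ≥0∞, 0 < ε →
    ∃ τ ∈ convexHull ℝ (pureState '' {ψ | ‖ψ‖ = 1 ∧ energy ψ ≤ ENNReal.ofReal E}),
      traceNorm (ρ - τ) < ε}

/-- A statistical decomposition `ρ = ∫ |Ψ_ω⟩⟨Ψ_ω| dμ(ω)` of `ρ` into pure states: the random unit
vector `Ψ` has mixture `ρ`.  On a countable `Ω` this reads `ρ = ∑ᵢ pᵢ |ψᵢ⟩⟨ψᵢ|`. -/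
structure IsDecomposition {Ω : Type} [MeasurableSpace Ω] (μ : Measure Ω) (Ψ : Ω → Mode)
    (ρ : Mode →L[ℂ] Mode) : Prop where
  isProbabilityMeasure : IsProbabilityMeasure μ
  aestronglyMeasurable : AEStronglyMeasurable Ψ μ
  norm_eq_one : ∀ᵐ ω ∂μ, ‖Ψ ω‖ = 1
  mixture : ∀ φ : Mode, ⟪φ, ρ φ⟫_ℂ = ∫ ω, ⟪φ, pureState (Ψ ω) φ⟫_ℂ ∂μ

/-- The stellar rank of a mixed state: the infimum, over all statistical decompositions into pure
states, of the (essential) supremum of the stellar ranks of the pure states. -/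
def mixedStellarRank (ρ : Mode →L[ℂ] Mode) : ℕ∞ :=
  sInf {r | ∃ (Ω : Type) (_ : MeasurableSpace Ω) (μ : Measure Ω) (Ψ : Ω → Mode),
    IsDecomposition μ Ψ ρ ∧ r = essSup (fun ω => stellarRank (Ψ ω)) μ}

/-- `𝒮_r^E`: the states of `𝒮^E` of stellar rank at most `r`. -/
def boundedRank (r : ℕ) (E : ℝ) : Set (Mode →L[ℂ] Mode) :=
  {ρ | ρ ∈ energyBounded E ∧ mixedStellarRank ρ ≤ r}

/-! ### Quadratures and witnesses -/

/-- Multiplication by an essentially bounded function, as an operator on `L²(ℝ)`. -/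
def mulOp (g : ℝ → ℂ) (hg : MemLp g ∞ volume) : Mode →L[ℂ] Mode :=
  (ContinuousLinearMap.mul ℂ ℂ).holderL volume ∞ 2 2 (hg.toLp g)

theorem memLp_indicator_one {B : Set ℝ} (hB : MeasurableSet B) :
    MemLp (B.indicator fun _ => (1 : ℂ)) ∞ volume :=
  (memLp_top_const (1 : ℂ)).indicator hB

/-- The spectral projector `1_B(x̂)` of the position operator. -/
def indicatorOp {B : Set ℝ} (hB : MeasurableSet B) : Mode →L[ℂ] Mode :=
  mulOp (B.indicator fun _ => 1) (memLp_indicator_one hB)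

/-- The chirp `exp(i a x² / 2)`. -/
def chirp (a x : ℝ) : ℂ := Complex.exp (((a * x ^ 2 / 2 : ℝ) : ℂ) * Complex.I)

theorem memLp_chirp (a : ℝ) : MemLp (chirp a) ∞ volume := by
  refine memLp_top_of_bound (Continuous.aestronglyMeasurable (by unfold chirp; fun_prop)) 1
    (Filter.Eventually.of_forall fun x => ?_)
  rw [chirp, Complex.norm_exp_ofReal_mul_I]

/-- The Fourier transform `f ↦ (ξ ↦ ∫ exp(-2πixξ) f(x) dx)` on `L²(ℝ)`. -/
def fourierOp : Mode →L[ℂ] Mode :=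
  (Lp.fourierTransformₗᵢ ℝ ℂ).toLinearIsometry.toContinuousLinearMap

/-- For `sin θ ≠ 0`, the unitary `V_θ` (chirp, then Fourier transform) that diagonalises the
quadrature `q̂_θ = cos θ x̂ + sin θ p̂`, `p̂ = -i d/dx`.  Up to the change of variable
`q = 2π (sin θ) ξ`, `(V_θ ψ)(ξ)` is the quadrature wavefunction `⟨q|ψ⟩_{q̂_θ}`.
Conjugating `sin θ · p̂` by the chirp of parameter `cos θ / sin θ` gives `q̂_θ`, and the Fourier
transform turns `p̂` into multiplication by `2πξ`, so `V_θ q̂_θ V_θ* = 2π (sin θ) ξ`. -/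
def quadratureTransform (θ : ℝ) : Mode →L[ℂ] Mode :=
  fourierOp ∘L mulOp (chirp (Real.cos θ / Real.sin θ)) (memLp_chirp _)

/-- The spectral projector `1_B(q̂_θ) = ∫_B |q⟩⟨q|_{q̂_θ} dq` of the quadrature
`q̂_θ = cos θ x̂ + sin θ p̂`.  If `sin θ = 0` then `q̂_θ` is multiplication by `cos θ · x`. -/
def quadratureProjector (θ : ℝ) {B : Set ℝ} (hB : MeasurableSet B) : Mode →L[ℂ] Mode :=
  if Real.sin θ = 0 then
    indicatorOp (B := (fun x => Real.cos θ * x) ⁻¹' B) (measurable_const_mul _ hB)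
  else
    (quadratureTransform θ).adjoint ∘L
      indicatorOp (B := (fun ξ => 2 * Real.pi * Real.sin θ * ξ) ⁻¹' B)
        (measurable_const_mul _ hB) ∘L
      quadratureTransform θ

/-- The window `[x - η/2, x + η/2]`. -/
def window (x η : ℝ) : Set ℝ := Set.Icc (x - η / 2) (x + η / 2)

theorem measurableSet_window (x η : ℝ) : MeasurableSet (window x η) := measurableSet_Icc

/-- The single-quadrature witness `Ŵ_{θ,x,η}`. -/
def witness (θ x η : ℝ) : Mode →L[ℂ] Mode := quadratureProjector θ (measurableSet_window x η)

/-- The multiple-quadrature witness `∑ⱼ Ŵ_{θⱼ,xⱼ,ηⱼ}`. -/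
def multiWitness {N : ℕ} (θ x η : Fin N → ℝ) : Mode →L[ℂ] Mode :=
  ∑ j, witness (θ j) (x j) (η j)

/-- The Gaussian threshold value of the multiple-quadrature witness at energy `E`. -/
def threshold {N : ℕ} (E : ℝ) (θ x η : Fin N → ℝ) : ℝ :=
  sInf ((fun σ => (trace (σ ∘L multiWitness θ x η)).re) '' boundedRank 0 E)

/-! ### Measurement outcomes -/

/-- `X` is the outcome of a measurement of `q̂_θ` on the state `σ`: its law is given by the Born
rule `Pr[X ∈ B] = Tr(σ 1_B(q̂_θ))`. -/
structure IsOutcome {Ω : Type*} [MeasurableSpace Ω] (P : Measure Ω) (X : Ω → ℝ)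
    (σ : Mode →L[ℂ] Mode) (θ : ℝ) : Prop where
  aemeasurable : AEMeasurable X P
  born : ∀ (B : Set ℝ) (hB : MeasurableSet B),
    P.map X B = ENNReal.ofReal (trace (σ ∘L quadratureProjector θ hB)).re

/-- The fraction of the `M` outcomes falling in the window `[x - η/2, x + η/2]`. -/
def fractionInWindow {Ω : Type*} {M : ℕ} (X : Fin M → Ω → ℝ) (x η : ℝ) (ω : Ω) : ℝ :=
  (∑ k, (window x η).indicator (fun _ => (1 : ℝ)) (X k ω)) / M

end Bosonic

end

/-! ### Traces of states against bounded operators. -/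

section TraceClass

variable {H : Type*} [NormedAddCommGroup H] [InnerProductSpace ℂ H]

/-! Put p_j = Tr[σ 1_{I_j}]. The threshold is an infimum over a set containing σ, so it is at most Σ
p_j. If the frequencies sum to less than the threshold minus ε, one of them is at most p_j - ε/N; a
union bound, valid under any dependence between quadratures, reduces to `hoeffding_frequency_le`.
The analytic input is that the trace is additive and the infimum is over a set bounded below. Both
come from `summable_trace_comp`: write ρ = S†S with S Hilbert–Schmidt, so that the terms of Tr[ρA]
are ⟨S e_i, S A e_i⟩. -/

/-- Parseval's identity with values in `[0, ∞]`. -/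
theorem HilbertBasis.tsum_ofReal_norm_inner_sq {ι : Type*} (b : HilbertBasis ι ℂ H) (x : H) :
    ∑' i, ENNReal.ofReal (‖⟪b i, x⟫_ℂ‖ ^ 2) = ENNReal.ofReal (‖x‖ ^ 2) := by
  have h := (b.hasSum_inner_mul_inner x x).mapL Complex.reCLM
  have h' : HasSum (fun i => ‖⟪b i, x⟫_ℂ‖ ^ 2) (‖x‖ ^ 2) := by
    convert h using 1
    · ext i
      rw [← inner_conj_symm x (b i), mul_comm, RCLike.mul_conj]
      simp [← Complex.ofReal_pow]
    · simp [inner_self_eq_norm_sq_to_K, ← Complex.ofReal_pow]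
  rw [← ENNReal.ofReal_tsum_of_nonneg (fun _ => by positivity) h'.summable, h'.tsum_eq]

variable [CompleteSpace H]

/-- The Hilbert–Schmidt norms of an operator and of its adjoint agree. -/
theorem HilbertBasis.tsum_norm_sq_adjoint {ι : Type*} (b : HilbertBasis ι ℂ H) (T : H →L[ℂ] H) :
    ∑' i, ENNReal.ofReal (‖T.adjoint (b i)‖ ^ 2) = ∑' i, ENNReal.ofReal (‖T (b i)‖ ^ 2) := by
  simp_rw [← b.tsum_ofReal_norm_inner_sq]
  rw [ENNReal.tsum_comm]
  refine tsum_congr fun i => tsum_congr fun j => ?_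
  rw [ContinuousLinearMap.adjoint_inner_right, norm_inner_symm]

/-- The Hilbert–Schmidt operators form a right ideal. -/
theorem HilbertBasis.tsum_norm_sq_comp_le {ι : Type*} (b : HilbertBasis ι ℂ H)
    (S A : H →L[ℂ] H) :
    ∑' i, ENNReal.ofReal (‖S (A (b i))‖ ^ 2) ≤
      ENNReal.ofReal (‖A‖ ^ 2) * ∑' i, ENNReal.ofReal (‖S (b i)‖ ^ 2) := by
  have h := b.tsum_norm_sq_adjoint (S ∘L A)
  simp only [ContinuousLinearMap.comp_apply] at h
  -- After taking adjoints, A† acts last, so its operator norm factors out term by term.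
  rw [← h, ← b.tsum_norm_sq_adjoint S, ← ENNReal.tsum_mul_left]
  refine ENNReal.tsum_le_tsum fun i => ?_
  rw [← ENNReal.ofReal_mul (by positivity), ContinuousLinearMap.adjoint_comp, ← mul_pow]
  gcongr
  simpa using A.adjoint.le_opNorm (S.adjoint (b i))

theorem hasSum_toReal_of_tsum_ofReal_ne_top {ι : Type*} {f : ι → ℝ} (hf : ∀ i, 0 ≤ f i)
    (h : ∑' i, ENNReal.ofReal (f i) ≠ ∞) :
    HasSum f (∑' i, ENNReal.ofReal (f i)).toReal := by
  rw [ENNReal.tsum_toReal_eq fun _ => ENNReal.ofReal_ne_top]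
  simpa only [ENNReal.toReal_ofReal (hf _)] using ENNReal.hasSum_toReal h

namespace Bosonic

/-- A positive operator of trace one has the form `S† S` with `S` of Hilbert–Schmidt norm one. -/
theorem exists_sq_eq_of_traceNorm_eq_one {ρ : H →L[ℂ] H} (hρ : ρ.IsPositive)
    (h1 : traceNorm ρ = 1) :
    ∃ S : H →L[ℂ] H, (∀ x y, ⟪x, ρ y⟫_ℂ = ⟪S x, S y⟫_ℂ) ∧
      ∑' i, ENNReal.ofReal (‖S (someBasis H i)‖ ^ 2) = 1 := by
  have hρ0 : 0 ≤ ρ := (ContinuousLinearMap.nonneg_iff_isPositive ρ).2 hρ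
  have hS : (CFC.sqrt ρ).IsPositive :=
    (ContinuousLinearMap.nonneg_iff_isPositive _).1 (CFC.sqrt_nonneg ρ)
  have hinner : ∀ x y, ⟪x, ρ y⟫_ℂ = ⟪CFC.sqrt ρ x, CFC.sqrt ρ y⟫_ℂ := fun x y => by
    conv_lhs => rw [← CFC.sqrt_mul_sqrt_self ρ hρ0]
    rw [mul_apply_eq_comp]
    exact (hS.isSymmetric _ _).symm
  refine ⟨CFC.sqrt ρ, hinner, ?_⟩
  rw [← h1, traceNorm, CFC.abs_of_nonneg ρ hρ0]
  refine tsum_congr fun i => ?_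
  rw [hinner, inner_self_eq_norm_sq_to_K]
  simp [← Complex.ofReal_pow]

/-- The trace of a state against a bounded operator converges absolutely, with a bound depending
only on the operator norm. -/
theorem summable_trace_comp {ρ : H →L[ℂ] H} (hρ : ρ.IsPositive) (h1 : traceNorm ρ = 1)
    (A : H →L[ℂ] H) :
    Summable (fun i => ⟪someBasis H i, (ρ ∘L A) (someBasis H i)⟫_ℂ) ∧
      ‖trace (ρ ∘L A)‖ ≤ (1 + ‖A‖ ^ 2) / 2 := by
  obtain ⟨S, hS, hS1⟩ := exists_sq_eq_of_traceNorm_eq_one hρ h1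
  have hle := (someBasis H).tsum_norm_sq_comp_le S A
  rw [hS1, mul_one] at hle
  have hsum1 := hasSum_toReal_of_tsum_ofReal_ne_top
    (f := fun i => ‖S (someBasis H i)‖ ^ 2) (fun _ => by positivity) (hS1 ▸ ENNReal.one_ne_top)
  have hsum2 := hasSum_toReal_of_tsum_ofReal_ne_top
    (f := fun i => ‖S (A (someBasis H i))‖ ^ 2) (fun _ => by positivity)
    (ne_top_of_le_ne_top ENNReal.ofReal_ne_top hle)
  have hle' := ENNReal.toReal_le_of_le_ofReal (by positivity) hle
  rw [hS1, ENNReal.toReal_one] at hsum1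
  have hsum := (hsum1.add hsum2).div_const 2
  have hterm : ∀ i, ‖⟪someBasis H i, (ρ ∘L A) (someBasis H i)⟫_ℂ‖ ≤
      (‖S (someBasis H i)‖ ^ 2 + ‖S (A (someBasis H i))‖ ^ 2) / 2 := fun i => by
    rw [ContinuousLinearMap.comp_apply, hS]
    refine (norm_inner_le_norm _ _).trans ?_
    -- AM-GM loses nothing that matters: any bound depending only on ‖A‖ suffices.
    linarith [two_mul_le_add_sq ‖S (someBasis H i)‖ ‖S (A (someBasis H i))‖]
  refine ⟨.of_norm_bounded hsum.summable hterm, ?_⟩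
  exact (tsum_of_norm_bounded hsum hterm).trans (by gcongr)

theorem trace_comp_sum {ρ : H →L[ℂ] H} (hρ : ρ.IsPositive) (h1 : traceNorm ρ = 1)
    {ι : Type*} (s : Finset ι) (A : ι → H →L[ℂ] H) :
    trace (ρ ∘L ∑ j ∈ s, A j) = ∑ j ∈ s, trace (ρ ∘L A j) := by
  unfold trace
  rw [← Summable.tsum_finsetSum fun j _ => (summable_trace_comp hρ h1 (A j)).1]
  refine tsum_congr fun i => ?_
  simp

end Bosonic

end TraceClass

/-! ### Concentration of empirical frequencies. -/

section Hoeffding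

/-- Hoeffding's lower tail bound for the empirical frequency of an event. -/
theorem hoeffding_frequency_le {Ω α : Type*} [MeasurableSpace Ω] [MeasurableSpace α]
    {P : Measure Ω} [IsProbabilityMeasure P] {M : ℕ} {X : Fin M → Ω → α}
    (hX : ∀ k, AEMeasurable (X k) P) (hindep : iIndepFun X P) {B : Set α} (hB : MeasurableSet B)
    {p t : ℝ} (ht : 0 ≤ t) (hp : ∀ k, p ≤ (P.map (X k)).real B) :
    P.real {ω | (∑ k, B.indicator (fun _ => (1 : ℝ)) (X k ω)) / M ≤ p - t} ≤
      Real.exp (-2 * M * t ^ 2) := by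
  rcases Nat.eq_zero_or_pos M with rfl | hM
  · simp
  have hM' : (0 : ℝ) < M := by exact_mod_cast hM
  set f : α → ℝ := B.indicator fun _ => 1 with hf
  have hfm : Measurable f := measurable_const.indicator hB
  have hfX : ∀ k, AEMeasurable (fun ω => f (X k ω)) P := fun k => hfm.comp_aemeasurable (hX k)
  have hint : ∀ k, P[fun ω => f (X k ω)] = (P.map (X k)).real B := fun k => by
    rw [← integral_map (hX k) hfm.aestronglyMeasurable, hf, integral_indicator hB]
    simp
  -- Hoeffding's lemma: a variable in [0, 1] has variance proxy 1/4. The sign turns the upper tail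
  -- bound into a lower one.
  have hsub : ∀ k ∈ Finset.univ, HasSubgaussianMGF
      (fun ω => -(f (X k ω) - P[fun ω => f (X k ω)])) ((‖(1 : ℝ) - 0‖₊ / 2) ^ 2) P :=
    fun k _ => (hasSubgaussianMGF_of_mem_Icc (hfX k) (Filter.Eventually.of_forall fun ω => by
      by_cases h : X k ω ∈ B <;> simp [hf, h])).neg
  have hind : iIndepFun (fun k ω => -(f (X k ω) - P[fun ω => f (X k ω)])) P :=
    hindep.comp (fun k y => -(f y - ∫ ω, f (X k ω) ∂P))
      fun k => (hfm.sub_const _).neg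
  -- The exponent is -(Mt)²/(2 · M/4) = -2Mt².
  have key := HasSubgaussianMGF.measure_sum_ge_le_of_iIndepFun hind hsub
    (ε := M * t) (by positivity)
  refine (measureReal_mono fun ω hω => ?_).trans (key.trans_eq ?_)
  · simp only [Set.mem_ofPred_eq] at hω ⊢
    rw [div_le_iff₀ hM'] at hω
    have hsum : (M : ℝ) * p ≤ ∑ k, P[fun ω => f (X k ω)] := by
      simpa using Finset.card_nsmul_le_sum Finset.univ (fun k => P[fun ω => f (X k ω)]) p
        fun k _ => (hp k).trans_eq (hint k).symm
    rw [Finset.sum_neg_distrib, Finset.sum_sub_distrib]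
    linarith
  · congr 1
    simp
    field_simp

end Hoeffding

/-! ### Threshold, Born rule and union bound. -/

namespace Bosonic

/-- The expectation values of a multiple-quadrature witness on states are bounded below. -/
theorem bddBelow_trace_multiWitness {N : ℕ} (E : ℝ) (θ x η : Fin N → ℝ) :
    BddBelow ((fun σ => (trace (σ ∘L multiWitness θ x η)).re) '' boundedRank 0 E) := by
  -- The bound is uniform in the state, as it involves only the norm of the witness.
  refine ⟨-((1 + ‖multiWitness θ x η‖ ^ 2) / 2), ?_⟩
  rintro _ ⟨τ, hτ, rfl⟩
  exact (abs_le.1 ((Complex.abs_re_le_norm _).trans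
    (summable_trace_comp hτ.1.1.1 hτ.1.1.2 _).2)).1

theorem threshold_le_sum_trace {N : ℕ} {E : ℝ} (θ x η : Fin N → ℝ) {σ : Mode →L[ℂ] Mode}
    (hσ : σ ∈ boundedRank 0 E) :
    threshold E θ x η ≤ ∑ j, (trace (σ ∘L witness (θ j) (x j) (η j))).re := by
  refine (csInf_le (bddBelow_trace_multiWitness E θ x η) ⟨σ, hσ, rfl⟩).trans_eq ?_
  simp only [multiWitness]
  rw [trace_comp_sum hσ.1.1.1 hσ.1.1.2, Complex.re_sum]

/-- `ENNReal.ofReal` truncates at zero, so this inequality needs no positivity of the trace; a lower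
tail needs only this direction. -/
theorem IsOutcome.trace_witness_le {Ω : Type*} [MeasurableSpace Ω] {P : Measure Ω} {X : Ω → ℝ}
    {σ : Mode →L[ℂ] Mode} {θ : ℝ} (h : IsOutcome P X σ θ) (x η : ℝ) :
    (trace (σ ∘L witness θ x η)).re ≤ (P.map X).real (window x η) := by
  rw [measureReal_def, h.born _ (measurableSet_window x η), ENNReal.toReal_ofReal']
  exact le_max_left _ _

end Bosonic

theorem mainTheorem6 {N : ℕ} (θ x η : Fin N → ℝ) (hη : ∀ j, 0 < η j) (E : ℝ) (hE : 0 ≤ E)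
    (σ : Bosonic.Mode →L[ℂ] Bosonic.Mode) (hσ : σ ∈ Bosonic.boundedRank 0 E)
    {Ω : Type*} [MeasurableSpace Ω] (P : Measure Ω) [IsProbabilityMeasure P]
    (M : Fin N → ℕ) (q : (j : Fin N) → Fin (M j) → Ω → ℝ)
    (hq : ∀ j k, Bosonic.IsOutcome P (q j k) σ (θ j))
    (hindep : ∀ j, iIndepFun (q j) P)
    (ε : ℝ) (hε : 0 < ε) :
    P.real {ω | ∑ j, Bosonic.fractionInWindow (q j) (x j) (η j) ω <
        Bosonic.threshold E θ x η - ε} ≤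
      ∑ j, Real.exp (-2 * (M j : ℝ) * (ε / (N : ℝ)) ^ 2) := by
  have hsub : {ω | ∑ j, Bosonic.fractionInWindow (q j) (x j) (η j) ω <
      Bosonic.threshold E θ x η - ε} ⊆ ⋃ j, {ω | Bosonic.fractionInWindow (q j) (x j) (η j) ω ≤
        (Bosonic.trace (σ ∘L Bosonic.witness (θ j) (x j) (η j))).re - ε / N} := by
    intro ω hω
    by_contra hcon
    simp only [Set.mem_iUnion, Set.mem_ofPred_eq, not_exists, not_le] at hω hcon
    have h1 := Finset.sum_le_sum fun j (_ : j ∈ Finset.univ) => (hcon j).le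
    rw [Finset.sum_sub_distrib, Finset.sum_const, Finset.card_univ, Fintype.card_fin,
      nsmul_eq_mul] at h1
    -- Only an inequality, since ε / 0 = 0 when N = 0.
    have h2 : (N : ℝ) * (ε / N) ≤ ε := by
      rcases eq_or_ne (N : ℝ) 0 with h | h
      · simpa [h] using hε.le
      · exact (mul_div_cancel₀ ε h).le
    linarith [Bosonic.threshold_le_sum_trace θ x η hσ]
  refine (measureReal_mono hsub).trans ((measureReal_iUnion_fintype_le _).trans ?_)
  exact Finset.sum_le_sum fun j _ => hoeffding_frequency_le (fun k => (hq j k).aemeasurable)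
    (hindep j) (Bosonic.measurableSet_window _ _) (by positivity)
    fun k => (hq j k).trace_witness_le (x j) (η j)
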